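/- An integral Hodge structure $(L,h)$ is a finitely generated free $\mathbb{Z}$-module $L$ together with a decomposition $L_{\mathbb C}=\bigoplus_{(p,q)\in\mathbb{Z}^2}V^{p,q}$ with $\overline{V^{p,q}}=V^{q,p}$, such that $L=\bigoplus_{n\in\mathbb{Z}}L^n$, where $(L_{\mathbb R})^n=L_{\mathbb R}\cap\bigoplus_{p+q=n}V^{p,q}$ and $L^n=L\cap (L_{\mathbb R})^n$; here $h:\mathbb{C}^\times\to\mathrm{GL}(L_{\mathbb R})$ is the action for which $h(z)$ is multiplication by $z^{-p}\bar z^{-q}$ on $V^{p,q}$. Put $\mathbb{Z}(n)=(2\pi i)^n\mathbb{Z}\subset\mathbb{C}$. A polarisation on $(L,h)$ is a $\mathbb{Z}$-bilinear pairing $\psi:L\times L\to\bigoplus_{n\in\mathbb{Z}}\mathbb{Z}(-n)$ with $\psi(L^m,L^n)=0$ for $m\neq n$ and $\psi(L^n,L^n)\subseteq\mathbb{Z}(-n)$ such that, for every $n$ and all $x,y\in (L_{\mathbb R})^n$, one has $\psi_{\mathbb R}(h(z)x,h(z)y)=(z\bar z)^{-n}\psi_{\mathbb R}(x,y)$ for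 all $z\in\mathbb{C}^\times$, and the form $(x,y)\mapsto(2\pi i)^n\psi_{\mathbb R}(x,h(i)y)$ on $(L_{\mathbb R})^n$ is real-valued, symmetric and positive definite. A morphism of polarised integral Hodge structures is a $\mathbb{Z}$-linear map that preserves the pairings and whose complexification preserves the subspaces of type $(p,q)$ for all $(p,q)$. Finite products are formed componentwise: the lattice is $\prod_i L_i$, the subspace of type $(p,q)$ is the product of those of the factors, and $\psi(x,y)=\sum_i\psi_i(x_i,y_i)$. A polarised integral Hodge structure $(L,\psi,h)$ is indecomposable if $L\neq0$ and, whenever $L=L_1\oplus L_2$ with sublattices $L_1,L_2$ such that $L_{1,\mathbb R}$ and $L_{2,\mathbb R}$ are $h$-stable and $\psi(L_1,L_2)=\psi(L_2,L_1)=0$, one has $L_1=0$ or $L_2=0$. **Corollary 1.6.** Let $(L,\psi,h)$ be a polarised integral Hodge structure, and let \[(L,\psi,h)\simeq\prod_{i=1}^r(L_i,\psi_i,h_i)^{e_i},\] where $r$ and the $e_i$ are non-negative integers and the $(L_i,\psi_i,h_i)$ are indecomposable polarised integral Hodge structures with $(L_i,\psi_i,h_i)\not\simeq(L_j,\psi_j,h_j)$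 for $i\neq j$. Then there is an isomorphism of groups \[\mathrm{Aut}(L,\psi,h)\simeq\prod_{i=1}^r\bigl(\mathrm{Aut}(L_i,\psi_i,h_i)^{e_i}\rtimes S_{e_i}\bigr),\] where $S_{e_i}$, the symmetric group on $e_i$ letters, acts on $\mathrm{Aut}(L_i,\psi_i,h_i)^{e_i}$ by permuting the factors. -/

import Mathlib

open scoped TensorProduct DirectSum ComplexConjugate ComplexOrder

noncomputable section

/-! ### Real Hodge structures -/

section Real

variable (V : Type*) [AddCommGroup V] [Module ℝ V]

/-- Complex conjugation on `V_ℂ = ℂ ⊗ V`, through the factor `ℂ`. -/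
def conjTensor : ℂ ⊗[ℝ] V →ₗ[ℝ] ℂ ⊗[ℝ] V :=
  LinearMap.rTensor V Complex.conjAe.toLinearMap

/-- The real part `V_ℂ → V`, `z ⊗ v ↦ Re z • v`. -/
def reTensor : ℂ ⊗[ℝ] V →ₗ[ℝ] V :=
  (TensorProduct.lid ℝ V).toLinearMap ∘ₗ LinearMap.rTensor V Complex.reLm

/-- A Hodge decomposition of a real vector space `V`: a decomposition of `V_ℂ` into complex
subspaces `V^{p,q}` such that the conjugate of `V^{p,q}` is `V^{q,p}`. -/
structure HodgeDecomposition where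
  comp : ℤ × ℤ → Submodule ℂ (ℂ ⊗[ℝ] V)
  isInternal : DirectSum.IsInternal comp
  conj_comp : ∀ p q : ℤ,
    conjTensor V '' (comp (p, q) : Set (ℂ ⊗[ℝ] V)) = (comp (q, p) : Set (ℂ ⊗[ℝ] V))

namespace HodgeDecomposition

variable {V}
variable (D : HodgeDecomposition V)

/-- The weight `n` part `V^n` of `V`: the real vectors of `⨁_{p+q=n} V^{p,q}`. -/
def weight (n : ℤ) : Submodule ℝ V :=
  ((⨆ pq : {pq : ℤ × ℤ // pq.1 + pq.2 = n}, D.comp pq).restrictScalars ℝ).comap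
    (TensorProduct.mk ℝ ℂ V 1)

/-- The action of `z ∈ ℂˣ = 𝕊(ℝ)` on `V_ℂ`: multiplication by `z^{-p} z̄^{-q}` on `V^{p,q}`. -/
def hC (z : ℂˣ) : ℂ ⊗[ℝ] V →ₗ[ℂ] ℂ ⊗[ℝ] V :=
  DirectSum.toModule ℂ (ℤ × ℤ) (ℂ ⊗[ℝ] V)
      (fun pq => ((z : ℂ) ^ (-pq.1) * (conj (z : ℂ)) ^ (-pq.2)) • (D.comp pq).subtype) ∘ₗ
    (LinearEquiv.ofBijective (DirectSum.coeLinearMap D.comp) D.isInternal).symm.toLinearMap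

/-- The action `h(z)` of `z ∈ ℂˣ` on `V`; the action on `V_ℂ` is defined over `ℝ`
(see `one_tmul_h`), so that `h(z)` is its restriction to the real vectors. -/
def h (z : ℂˣ) : V →ₗ[ℝ] V :=
  reTensor V ∘ₗ (D.hC z).restrictScalars ℝ ∘ₗ TensorProduct.mk ℝ ℂ V 1

theorem hC_of_mem (z : ℂˣ) (pq : ℤ × ℤ) {v : ℂ ⊗[ℝ] V} (hv : v ∈ D.comp pq) :
    D.hC z v = ((z : ℂ) ^ (-pq.1) * (conj (z : ℂ)) ^ (-pq.2)) • v := by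
  have : (LinearEquiv.ofBijective (DirectSum.coeLinearMap D.comp) D.isInternal).symm v
      = DirectSum.lof ℂ (ℤ × ℤ) (fun i => D.comp i) pq ⟨v, hv⟩ := by
    rw [LinearEquiv.symm_apply_eq]
    exact (DirectSum.coeLinearMap_lof D.comp pq ⟨v, hv⟩).symm
  rw [hC, LinearMap.comp_apply, LinearEquiv.coe_coe, this, DirectSum.toModule_lof]
  rfl

theorem iSup_comp : (⨆ pq, D.comp pq) = ⊤ :=
  D.isInternal.submodule_iSup_eq_top

theorem hC_conj (z : ℂˣ) (v : ℂ ⊗[ℝ] V) :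
    D.hC z (conjTensor V v) = conjTensor V (D.hC z v) := by
  have smul_conj : ∀ (a : ℂ) (w : ℂ ⊗[ℝ] V),
      conjTensor V (a • w) = conj a • conjTensor V w := by
    intro a w
    induction w with
    | zero => simp
    | add x y hx hy => simp [hx, hy]
    | tmul c x => simp [conjTensor, TensorProduct.smul_tmul']
  have hv : v ∈ ⨆ pq, D.comp pq := by rw [D.iSup_comp]; trivial
  induction hv using Submodule.iSup_induction' with
  | zero => simp
  | add x y _ _ hx hy => simp [hx, hy]
  | mem pq x hx =>
    obtain ⟨p, q⟩ := pq
    have hx' : conjTensor V x ∈ D.comp (q, p) := by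
      have : conjTensor V x ∈ conjTensor V '' (D.comp (p, q) : Set (ℂ ⊗[ℝ] V)) := ⟨x, hx, rfl⟩
      rwa [D.conj_comp p q] at this
    rw [D.hC_of_mem z _ hx, D.hC_of_mem z _ hx', smul_conj]
    simp [mul_comm]

theorem one_tmul_h (z : ℂˣ) (v : V) :
    (1 : ℂ) ⊗ₜ[ℝ] D.h z v = D.hC z (1 ⊗ₜ v) := by
  have key : ∀ w : ℂ ⊗[ℝ] V, (2 : ℝ) • ((1 : ℂ) ⊗ₜ[ℝ] reTensor V w) = w + conjTensor V w := by
    intro w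
    induction w with
    | zero => simp
    | add x y hx hy =>
      simp only [map_add, TensorProduct.tmul_add, smul_add, hx, hy]
      abel
    | tmul c x =>
      simp only [reTensor, conjTensor, LinearMap.comp_apply, LinearMap.rTensor_tmul,
        LinearEquiv.coe_coe, TensorProduct.lid_tmul, ← TensorProduct.add_tmul,
        TensorProduct.tmul_smul, TensorProduct.smul_tmul']
      congr 1
      apply Complex.ext <;> simp
      ring
  have h1 : conjTensor V ((1 : ℂ) ⊗ₜ[ℝ] v) = 1 ⊗ₜ v := by simp [conjTensor]
  have h2 := key (D.hC z (1 ⊗ₜ v))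
  rw [← D.hC_conj, h1, ← two_smul ℝ] at h2
  exact smul_right_injective _ (two_ne_zero' ℝ) h2

end HodgeDecomposition

end Real

/-! ### Integral Hodge structures -/

/-- The weight `n` part `L^n = L ∩ (L_ℝ)^n` of a lattice `L` with a Hodge decomposition of
`L_ℝ = ℝ ⊗ L`. -/
def HodgeDecomposition.latticeWeight {L : Type*} [AddCommGroup L]
    (D : HodgeDecomposition (ℝ ⊗[ℤ] L)) (n : ℤ) : Submodule ℤ L where
  carrier := {x | (1 : ℝ) ⊗ₜ[ℤ] x ∈ D.weight n}
  zero_mem' := by simp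
  add_mem' := by
    intro x y hx hy
    rw [Set.mem_ofPred_eq, TensorProduct.tmul_add]
    exact add_mem hx hy
  smul_mem' := by
    intro c x hx
    rw [Set.mem_ofPred_eq, TensorProduct.tmul_smul]
    exact zsmul_mem hx c

/-- An integral Hodge structure on a finite free `ℤ`-module `L`: a Hodge decomposition of
`L_ℝ = ℝ ⊗ L` such that `L` is the direct sum of the `L ∩ (L_ℝ)^n`. -/
structure IntegralHodgeStructure (L : Type*) [AddCommGroup L] [Module.Free ℤ L]
    [Module.Finite ℤ L] extends HodgeDecomposition (ℝ ⊗[ℤ] L) where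
  lattice_isInternal : DirectSum.IsInternal toHodgeDecomposition.latticeWeight

/-- The Tate twist `ℤ(n) = (2πi)^n ℤ`, as a subgroup of `ℂ`. -/
def tateTwist (n : ℤ) : Submodule ℤ ℂ :=
  Submodule.span ℤ {(2 * Real.pi * Complex.I : ℂ) ^ n}

namespace IntegralHodgeStructure

variable {L : Type*} [AddCommGroup L] [Module.Free ℤ L] [Module.Finite ℤ L]
variable {L' : Type*} [AddCommGroup L'] [Module.Free ℤ L'] [Module.Finite ℤ L']

/-- A `ℤ`-linear map is a morphism of integral Hodge structures if its complexification respects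
the Hodge decompositions. -/
def IsHodgeMorphism (S : IntegralHodgeStructure L) (S' : IntegralHodgeStructure L')
    (f : L →ₗ[ℤ] L') : Prop :=
  ∀ pq : ℤ × ℤ, ∀ v ∈ S.comp pq, (f.baseChange ℝ).baseChange ℂ v ∈ S'.comp pq

/-- A sublattice `M` is a Hodge substructure if `M_ℝ ⊆ L_ℝ` is stable under the action of `h`. -/
def IsHodgeSubstructure (S : IntegralHodgeStructure L) (M : Submodule ℤ L) : Prop :=
  ∀ z : ℂˣ, ∀ x ∈ M.baseChange ℝ, S.h z x ∈ M.baseChange ℝ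

end IntegralHodgeStructure

/-! ### Polarisations -/

/-- For a pairing `ψ : L × L → ⨁ₙ ℤ(-n)`, the `ℝ`-bilinear extension to `L_ℝ` of the component of
`ψ` in `ℤ(-n) ⊆ ℂ`. -/
def realPairing {L : Type*} [AddCommGroup L]
    (ψ : L →ₗ[ℤ] L →ₗ[ℤ] ⨁ n : ℤ, tateTwist (-n)) (n : ℤ) :
    ℝ ⊗[ℤ] L →ₗ[ℝ] ℝ ⊗[ℤ] L →ₗ[ℝ] ℂ :=
  LinearMap.liftBaseChange ℝ
    (((LinearMap.liftBaseChangeEquiv ℝ (R := ℤ) (M := L) (N := ℂ)).toLinearMap.restrictScalars ℤ) ∘ₗ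
      ψ.compr₂ ((tateTwist (-n)).subtype ∘ₗ
        DirectSum.component ℤ ℤ (fun n : ℤ => tateTwist (-n)) n))

theorem realPairing_tmul {L : Type*} [AddCommGroup L]
    (ψ : L →ₗ[ℤ] L →ₗ[ℤ] ⨁ n : ℤ, tateTwist (-n)) (n : ℤ) (a b : ℝ) (x y : L) :
    realPairing ψ n (a ⊗ₜ x) (b ⊗ₜ y) = a * b * (ψ x y n : ℂ) := by
  simp only [realPairing, LinearMap.liftBaseChange_tmul, LinearMap.comp_apply,
    LinearMap.smul_apply, LinearMap.coe_restrictScalars, LinearEquiv.coe_coe,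
    LinearMap.compr₂_apply, Complex.real_smul, mul_assoc]
  rfl

/-- A polarised integral Hodge structure `(L, ψ, h)` on a finite free `ℤ`-module `L`. -/
structure PolarisedHodgeStructure (L : Type*) [AddCommGroup L] [Module.Free ℤ L]
    [Module.Finite ℤ L] extends IntegralHodgeStructure L where
  /-- the pairing `ψ : L × L → ⨁ₙ ℤ(-n)` -/
  ψ : L →ₗ[ℤ] L →ₗ[ℤ] ⨁ n : ℤ, tateTwist (-n)
  /-- `ψ` respects the gradings by weights: `ψ(L^m, L^n) = 0` for `m ≠ n`, … -/
  ψ_of_ne : ∀ m n : ℤ, m ≠ n → ∀ x ∈ toIntegralHodgeStructure.latticeWeight m,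
    ∀ y ∈ toIntegralHodgeStructure.latticeWeight n, ψ x y = 0
  /-- … and `ψ(L^n, L^n) ⊆ ℤ(-n)`. -/
  ψ_weight : ∀ n : ℤ, ∀ x ∈ toIntegralHodgeStructure.latticeWeight n,
    ∀ y ∈ toIntegralHodgeStructure.latticeWeight n, ∀ k : ℤ, k ≠ n → ψ x y k = 0
  /-- `ψ_ℝ(h(z)x, h(z)y) = (z z̄)^{-n} ψ_ℝ(x, y)` on `(L_ℝ)^n`. -/
  ψ_equivariant : ∀ n : ℤ, ∀ x ∈ toIntegralHodgeStructure.weight n,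
    ∀ y ∈ toIntegralHodgeStructure.weight n, ∀ z : ℂˣ,
      realPairing ψ n (toIntegralHodgeStructure.h z x) (toIntegralHodgeStructure.h z y) =
        ((z : ℂ) * conj (z : ℂ)) ^ (-n) * realPairing ψ n x y
  /-- `φ(x, y) = (2πi)^n ψ_ℝ(x, h(i)y)` is symmetric on `(L_ℝ)^n`. -/
  φ_symm : ∀ n : ℤ, ∀ x ∈ toIntegralHodgeStructure.weight n,
    ∀ y ∈ toIntegralHodgeStructure.weight n,
      (2 * Real.pi * Complex.I : ℂ) ^ n *
          realPairing ψ n x (toIntegralHodgeStructure.h (Units.mk0 Complex.I Complex.I_ne_zero) y) =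
        (2 * Real.pi * Complex.I : ℂ) ^ n *
          realPairing ψ n y (toIntegralHodgeStructure.h (Units.mk0 Complex.I Complex.I_ne_zero) x)
  /-- `φ` is positive definite on `(L_ℝ)^n`; `0 < w` for `w : ℂ` says that `w` is a positive real
  number. -/
  φ_pos : ∀ n : ℤ, ∀ x ∈ toIntegralHodgeStructure.weight n, x ≠ 0 →
    0 < (2 * Real.pi * Complex.I : ℂ) ^ n *
      realPairing ψ n x (toIntegralHodgeStructure.h (Units.mk0 Complex.I Complex.I_ne_zero) x)

/-! ### Products of Hodge decompositions -/

section Prod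

set_option linter.unusedSectionVars false

theorem isInternal_of_proj {R ι κ M : Type*} [Ring R] [Fintype ι] [DecidableEq κ]
    [AddCommGroup M] [Module R M] {Q : ι → Type*} [∀ i, AddCommGroup (Q i)]
    [∀ i, Module R (Q i)] (p : ∀ i, M →ₗ[R] Q i) (s : ∀ i, Q i →ₗ[R] M)
    (hsp : ∀ x, ∑ i, s i (p i x) = x) (A : ∀ i, κ → Submodule R (Q i))
    (hA : ∀ i, DirectSum.IsInternal (A i)) (B : κ → Submodule R M)
    (hB : ∀ k x, x ∈ B k ↔ ∀ i, p i x ∈ A i k) (hs : ∀ i k, ∀ x ∈ A i k, s i x ∈ B k) :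
    DirectSum.IsInternal B := by
  rw [DirectSum.isInternal_submodule_iff_iSupIndep_and_iSup_eq_top]
  constructor
  · intro k
    rw [Submodule.disjoint_def]
    intro x hx hx'
    have hmap : ∀ i, p i x ∈ ⨆ (j : κ) (_ : j ≠ k), A i j := by
      intro i
      have hle : (⨆ (j : κ) (_ : j ≠ k), B j) ≤ (⨆ (j : κ) (_ : j ≠ k), A i j).comap (p i) := by
        refine iSup₂_le fun j hj y hy => ?_
        exact (le_iSup₂_of_le (f := fun (j : κ) (_ : j ≠ k) => A i j) j hj le_rfl)
          ((hB j y).1 hy i)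
      exact hle hx'
    rw [← hsp x]
    refine Finset.sum_eq_zero fun i _ => ?_
    rw [Submodule.disjoint_def.1 ((hA i).submodule_iSupIndep k) _ ((hB k x).1 hx i) (hmap i),
      map_zero]
  · rw [eq_top_iff]
    intro x _
    rw [← hsp x]
    refine Submodule.sum_mem _ fun i _ => ?_
    have hle : (⨆ k, A i k) ≤ (⨆ k, B k).comap (s i) :=
      iSup_le fun k y hy => (le_iSup B k) (hs i k y hy)
    exact hle (by rw [(hA i).submodule_iSup_eq_top]; trivial)

theorem HodgeDecomposition.hC_comm {V V' : Type*} [AddCommGroup V] [Module ℝ V] [AddCommGroup V']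
    [Module ℝ V'] (D : HodgeDecomposition V) (D' : HodgeDecomposition V') (f : V →ₗ[ℝ] V')
    (hf : ∀ pq, ∀ v ∈ D.comp pq, f.baseChange ℂ v ∈ D'.comp pq) (z : ℂˣ) (v : ℂ ⊗[ℝ] V) :
    f.baseChange ℂ (D.hC z v) = D'.hC z (f.baseChange ℂ v) := by
  have hv : v ∈ ⨆ pq, D.comp pq := by rw [D.iSup_comp]; trivial
  induction hv using Submodule.iSup_induction' with
  | zero => simp
  | add x y _ _ hx hy => simp [hx, hy]
  | mem pq x hx => rw [D.hC_of_mem z _ hx, D'.hC_of_mem z _ (hf pq x hx), map_smul]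

theorem HodgeDecomposition.h_comm {V V' : Type*} [AddCommGroup V] [Module ℝ V] [AddCommGroup V']
    [Module ℝ V'] (D : HodgeDecomposition V) (D' : HodgeDecomposition V') (f : V →ₗ[ℝ] V')
    (hf : ∀ pq, ∀ v ∈ D.comp pq, f.baseChange ℂ v ∈ D'.comp pq) (z : ℂˣ) (v : V) :
    f (D.h z v) = D'.h z (f v) := by
  have hre : ∀ w : ℂ ⊗[ℝ] V, f (reTensor V w) = reTensor V' (f.baseChange ℂ w) := by
    intro w
    induction w with
    | zero => simp
    | add x y hx hy => simp [hx, hy]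
    | tmul c x => simp [reTensor]
  simp only [HodgeDecomposition.h, LinearMap.comp_apply, LinearMap.coe_restrictScalars,
    TensorProduct.mk_apply, hre, D.hC_comm D' f hf, LinearMap.baseChange_tmul]

theorem HodgeDecomposition.map_weight {V V' : Type*} [AddCommGroup V] [Module ℝ V]
    [AddCommGroup V'] [Module ℝ V'] (D : HodgeDecomposition V) (D' : HodgeDecomposition V')
    (f : V →ₗ[ℝ] V') (hf : ∀ pq, ∀ v ∈ D.comp pq, f.baseChange ℂ v ∈ D'.comp pq) (n : ℤ) (v : V)
    (hv : v ∈ D.weight n) : f v ∈ D'.weight n := by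
  have hle : (⨆ pq : {pq : ℤ × ℤ // pq.1 + pq.2 = n}, D.comp pq) ≤
      (⨆ pq : {pq : ℤ × ℤ // pq.1 + pq.2 = n}, D'.comp pq).comap (f.baseChange ℂ) :=
    iSup_le fun pq y hy => (le_iSup (fun pq : {pq : ℤ × ℤ // pq.1 + pq.2 = n} => D'.comp pq) pq)
      (hf pq y hy)
  have := hle hv
  rwa [Submodule.mem_comap, TensorProduct.mk_apply, LinearMap.baseChange_tmul] at this

variable {ι : Type*} [Fintype ι] [DecidableEq ι] {P : ι → Type*} [∀ i, AddCommGroup (P i)]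

theorem sum_single_proj_real (x : ℝ ⊗[ℤ] (∀ i, P i)) :
    ∑ i, (LinearMap.single ℤ P i).baseChange ℝ
      ((LinearMap.proj i : (∀ i, P i) →ₗ[ℤ] P i).baseChange ℝ x) = x := by
  induction x with
  | zero => simp
  | add x y hx hy => simp only [map_add, Finset.sum_add_distrib, hx, hy]
  | tmul c x =>
    simp only [LinearMap.baseChange_tmul, ← TensorProduct.tmul_sum]
    congr 1
    ext i
    simp

theorem sum_single_proj_complex (x : ℂ ⊗[ℝ] (ℝ ⊗[ℤ] (∀ i, P i))) :
    ∑ i, ((LinearMap.single ℤ P i).baseChange ℝ).baseChange ℂ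
      (((LinearMap.proj i : (∀ i, P i) →ₗ[ℤ] P i).baseChange ℝ).baseChange ℂ x) = x := by
  induction x with
  | zero => simp
  | add x y hx hy => simp only [map_add, Finset.sum_add_distrib, hx, hy]
  | tmul c x =>
    simp only [LinearMap.baseChange_tmul, ← TensorProduct.tmul_sum, sum_single_proj_real]

theorem proj_single_complex (i j : ι) (v : ℂ ⊗[ℝ] (ℝ ⊗[ℤ] P i)) (W : Submodule ℂ (ℂ ⊗[ℝ] (ℝ ⊗[ℤ] P j)))
    (h : ∀ e : i = j, (e ▸ v : ℂ ⊗[ℝ] (ℝ ⊗[ℤ] P j)) ∈ W) :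
    ((LinearMap.proj j : (∀ i, P i) →ₗ[ℤ] P j).baseChange ℝ).baseChange ℂ
      (((LinearMap.single ℤ P i).baseChange ℝ).baseChange ℂ v) ∈ W := by
  rw [← LinearMap.comp_apply, ← LinearMap.baseChange_comp, ← LinearMap.baseChange_comp]
  by_cases e : i = j
  · subst e
    have : (LinearMap.proj i : (∀ i, P i) →ₗ[ℤ] P i) ∘ₗ LinearMap.single ℤ P i = LinearMap.id :=
      LinearMap.ext fun x => by simp
    rw [this]
    simpa using h rfl
  · have : (LinearMap.proj j : (∀ i, P i) →ₗ[ℤ] P j) ∘ₗ LinearMap.single ℤ P i = 0 :=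
      LinearMap.ext fun x => by simp [Ne.symm e]
    rw [this]
    simp

/-- The vectors of `(∏ᵢ Lᵢ)_ℂ` with all coordinates of type `(p, q)`. -/
def prodComp (D : ∀ i, HodgeDecomposition (ℝ ⊗[ℤ] P i)) (pq : ℤ × ℤ) :
    Submodule ℂ (ℂ ⊗[ℝ] (ℝ ⊗[ℤ] (∀ i, P i))) :=
  ⨅ i, ((D i).comp pq).comap
    (((LinearMap.proj i : (∀ i, P i) →ₗ[ℤ] P i).baseChange ℝ).baseChange ℂ)

theorem single_mem_prodComp (D : ∀ i, HodgeDecomposition (ℝ ⊗[ℤ] P i)) (i : ι) (pq : ℤ × ℤ)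
    (v : ℂ ⊗[ℝ] (ℝ ⊗[ℤ] P i)) (hv : v ∈ (D i).comp pq) :
    ((LinearMap.single ℤ P i).baseChange ℝ).baseChange ℂ v ∈ prodComp D pq := by
  refine (Submodule.mem_iInf _).2 fun j => proj_single_complex i j v _ ?_
  rintro rfl
  exact hv

theorem prodComp_isInternal (D : ∀ i, HodgeDecomposition (ℝ ⊗[ℤ] P i)) :
    DirectSum.IsInternal (prodComp D) :=
  isInternal_of_proj
    (fun i => ((LinearMap.proj i : (∀ i, P i) →ₗ[ℤ] P i).baseChange ℝ).baseChange ℂ)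
    (fun i => ((LinearMap.single ℤ P i).baseChange ℝ).baseChange ℂ) sum_single_proj_complex
    (fun i => (D i).comp) (fun i => (D i).isInternal) _
    (fun k x => by simp [prodComp, Submodule.mem_iInf]) (fun i k x hx => single_mem_prodComp D i k x hx)

theorem prodComp_conj (D : ∀ i, HodgeDecomposition (ℝ ⊗[ℤ] P i)) (p q : ℤ) :
    conjTensor (ℝ ⊗[ℤ] (∀ i, P i)) '' (prodComp D (p, q) : Set (ℂ ⊗[ℝ] (ℝ ⊗[ℤ] (∀ i, P i)))) =
      (prodComp D (q, p) : Set (ℂ ⊗[ℝ] (ℝ ⊗[ℤ] (∀ i, P i)))) := by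
  have hsub : ∀ p q : ℤ, ∀ v ∈ prodComp D (p, q),
      conjTensor (ℝ ⊗[ℤ] (∀ i, P i)) v ∈ prodComp D (q, p) := by
    intro p q v hv
    refine (Submodule.mem_iInf _).2 fun i => ?_
    have hcomm : ∀ w : ℂ ⊗[ℝ] (ℝ ⊗[ℤ] (∀ i, P i)),
        ((LinearMap.proj i : (∀ i, P i) →ₗ[ℤ] P i).baseChange ℝ).baseChange ℂ
          (conjTensor (ℝ ⊗[ℤ] (∀ i, P i)) w) = conjTensor (ℝ ⊗[ℤ] P i)
          (((LinearMap.proj i : (∀ i, P i) →ₗ[ℤ] P i).baseChange ℝ).baseChange ℂ w) := by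
      intro w
      induction w with
      | zero => simp
      | add x y hx hy => simp only [map_add, hx, hy]
      | tmul c x => simp [conjTensor]
    have := (Submodule.mem_iInf _).1 hv i
    rw [Submodule.mem_comap] at this ⊢
    rw [hcomm]
    have h2 := Set.mem_image_of_mem (conjTensor (ℝ ⊗[ℤ] P i)) this
    rwa [(D i).conj_comp p q] at h2
  have hinv : ∀ w : ℂ ⊗[ℝ] (ℝ ⊗[ℤ] (∀ i, P i)), conjTensor _ (conjTensor _ w) = w := by
    intro w
    induction w with
    | zero => simp
    | add x y hx hy => simp only [map_add, hx, hy]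
    | tmul c x => simp [conjTensor]
  refine Set.Subset.antisymm ?_ fun v hv => ⟨conjTensor _ v, hsub _ _ v hv, hinv v⟩
  rintro _ ⟨v, hv, rfl⟩
  exact hsub p q v hv

/-- The product of Hodge decompositions. -/
abbrev prodDecomposition (D : ∀ i, HodgeDecomposition (ℝ ⊗[ℤ] P i)) :
    HodgeDecomposition (ℝ ⊗[ℤ] (∀ i, P i)) where
  comp := prodComp D
  isInternal := prodComp_isInternal D
  conj_comp := prodComp_conj D

theorem proj_h_prodDecomposition (D : ∀ i, HodgeDecomposition (ℝ ⊗[ℤ] P i)) (i : ι) (z : ℂˣ)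
    (x : ℝ ⊗[ℤ] (∀ i, P i)) :
    (LinearMap.proj i : (∀ i, P i) →ₗ[ℤ] P i).baseChange ℝ ((prodDecomposition D).h z x) =
      (D i).h z ((LinearMap.proj i : (∀ i, P i) →ₗ[ℤ] P i).baseChange ℝ x) :=
  HodgeDecomposition.h_comm _ _ _ (fun _ _ hv => (Submodule.mem_iInf _).1 hv i) z x

theorem mem_weight_prodDecomposition (D : ∀ i, HodgeDecomposition (ℝ ⊗[ℤ] P i)) (n : ℤ)
    (x : ℝ ⊗[ℤ] (∀ i, P i)) : x ∈ (prodDecomposition D).weight n ↔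
      ∀ i, (LinearMap.proj i : (∀ i, P i) →ₗ[ℤ] P i).baseChange ℝ x ∈ (D i).weight n := by
  constructor
  · intro hx i
    exact HodgeDecomposition.map_weight _ _ _
      (fun _ _ hv => (Submodule.mem_iInf _).1 hv i) n x hx
  · intro hx
    rw [← sum_single_proj_real x]
    exact Submodule.sum_mem _ fun i _ => HodgeDecomposition.map_weight (D i) _ _
      (fun pq v hv => single_mem_prodComp D i pq v hv) n _ (hx i)

theorem mem_latticeWeight_prodDecomposition (D : ∀ i, HodgeDecomposition (ℝ ⊗[ℤ] P i)) (n : ℤ)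
    (x : ∀ i, P i) :
    x ∈ (prodDecomposition D).latticeWeight n ↔ ∀ i, x i ∈ (D i).latticeWeight n :=
  mem_weight_prodDecomposition D n _

/-- The pairing `ψ(x, y) = ∑ᵢ ψᵢ(xᵢ, yᵢ)` on `∏ᵢ Lᵢ`. -/
def prodPairing (ψ : ∀ i, P i →ₗ[ℤ] P i →ₗ[ℤ] ⨁ n : ℤ, tateTwist (-n)) :
    (∀ i, P i) →ₗ[ℤ] (∀ i, P i) →ₗ[ℤ] ⨁ n : ℤ, tateTwist (-n) :=
  ∑ i, (ψ i).compl₁₂ (LinearMap.proj i) (LinearMap.proj i)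

theorem prodPairing_apply (ψ : ∀ i, P i →ₗ[ℤ] P i →ₗ[ℤ] ⨁ n : ℤ, tateTwist (-n))
    (x y : ∀ i, P i) : prodPairing ψ x y = ∑ i, ψ i (x i) (y i) := by
  simp [prodPairing, LinearMap.sum_apply]

theorem realPairing_prod (ψ : ∀ i, P i →ₗ[ℤ] P i →ₗ[ℤ] ⨁ n : ℤ, tateTwist (-n)) (n : ℤ)
    (x y : ℝ ⊗[ℤ] (∀ i, P i)) : realPairing (prodPairing ψ) n x y =
      ∑ i, realPairing (ψ i) n ((LinearMap.proj i : (∀ i, P i) →ₗ[ℤ] P i).baseChange ℝ x)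
        ((LinearMap.proj i : (∀ i, P i) →ₗ[ℤ] P i).baseChange ℝ y) := by
  induction x with
  | zero => simp
  | add x x' hx hx' => simp only [map_add, LinearMap.add_apply, Finset.sum_add_distrib, hx, hx']
  | tmul a x =>
    induction y with
    | zero => simp
    | add y y' hy hy' => simp only [map_add, Finset.sum_add_distrib, hy, hy']
    | tmul b y =>
      simp only [LinearMap.baseChange_tmul, realPairing_tmul, prodPairing_apply,
        LinearMap.proj_apply]
      rw [← Finset.mul_sum, DFinsupp.finsetSum_apply, AddSubmonoidClass.coe_finsetSum]

end Prod

namespace PolarisedHodgeStructure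

variable {L : Type*} [AddCommGroup L] [Module.Free ℤ L] [Module.Finite ℤ L]
variable {L' : Type*} [AddCommGroup L'] [Module.Free ℤ L'] [Module.Finite ℤ L']

/-- A morphism of polarised integral Hodge structures. -/
def IsMorphism (S : PolarisedHodgeStructure L) (S' : PolarisedHodgeStructure L')
    (f : L →ₗ[ℤ] L') : Prop :=
  S.IsHodgeMorphism S'.toIntegralHodgeStructure f ∧ ∀ x y : L, S'.ψ (f x) (f y) = S.ψ x y

/-- An isomorphism: a morphism with an inverse that is a morphism. -/
def IsIsomorphism (S : PolarisedHodgeStructure L) (S' : PolarisedHodgeStructure L')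
    (f : L ≃ₗ[ℤ] L') : Prop :=
  S.IsMorphism S' f.toLinearMap ∧ S'.IsMorphism S f.symm.toLinearMap

/-- Existence of an isomorphism of polarised integral Hodge structures. -/
def Isomorphic (S : PolarisedHodgeStructure L) (S' : PolarisedHodgeStructure L') : Prop :=
  ∃ f : L ≃ₗ[ℤ] L', S.IsIsomorphism S' f

theorem isMorphism_id (S : PolarisedHodgeStructure L) : S.IsMorphism S LinearMap.id :=
  ⟨fun pq v hv => by simpa using hv, fun _ _ => rfl⟩

theorem IsMorphism.comp {L'' : Type*} [AddCommGroup L''] [Module.Free ℤ L'']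
    [Module.Finite ℤ L''] {S : PolarisedHodgeStructure L} {S' : PolarisedHodgeStructure L'}
    {S'' : PolarisedHodgeStructure L''} {g : L' →ₗ[ℤ] L''} {f : L →ₗ[ℤ] L'}
    (hg : S'.IsMorphism S'' g) (hf : S.IsMorphism S' f) : S.IsMorphism S'' (g ∘ₗ f) :=
  ⟨fun pq v hv => by
    rw [LinearMap.baseChange_comp, LinearMap.baseChange_comp]
    exact hg.1 pq _ (hf.1 pq v hv), fun x y => by simp [hg.2, hf.2]⟩

theorem IsIsomorphism.mul {S : PolarisedHodgeStructure L} {a b : L ≃ₗ[ℤ] L}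
    (ha : S.IsIsomorphism S a) (hb : S.IsIsomorphism S b) : S.IsIsomorphism S (a * b) := by
  have h1 : S.IsMorphism S (a.toLinearMap ∘ₗ b.toLinearMap) := ha.1.comp hb.1
  have h2 : S.IsMorphism S (b.symm.toLinearMap ∘ₗ a.symm.toLinearMap) := hb.2.comp ha.2
  rw [LinearEquiv.mul_eq_trans]
  exact And.intro h1 h2

theorem IsIsomorphism.inv {S : PolarisedHodgeStructure L} {a : L ≃ₗ[ℤ] L}
    (ha : S.IsIsomorphism S a) : S.IsIsomorphism S a⁻¹ :=
  And.intro ha.2 ha.1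

theorem IsIsomorphism.one (S : PolarisedHodgeStructure L) : S.IsIsomorphism S 1 :=
  And.intro S.isMorphism_id S.isMorphism_id

/-- The automorphism group `Aut(L, ψ, h)`. -/
def Aut (S : PolarisedHodgeStructure L) : Subgroup (L ≃ₗ[ℤ] L) where
  carrier := {f | S.IsIsomorphism S f}
  one_mem' := IsIsomorphism.one S
  mul_mem' := fun ha hb => IsIsomorphism.mul ha hb
  inv_mem' := fun ha => IsIsomorphism.inv ha

/-- `L = L₁ ⟂ L₂` is an orthogonal decomposition into Hodge substructures. -/
def IsOrthogonalDecomposition (S : PolarisedHodgeStructure L) (L₁ L₂ : Submodule ℤ L) : Prop :=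
  S.IsHodgeSubstructure L₁ ∧ S.IsHodgeSubstructure L₂ ∧ IsCompl L₁ L₂ ∧
    (∀ x ∈ L₁, ∀ y ∈ L₂, S.ψ x y = 0) ∧ (∀ x ∈ L₂, ∀ y ∈ L₁, S.ψ x y = 0)

/-- A polarised integral Hodge structure is indecomposable if it is nonzero and has no orthogonal
decomposition into two nonzero Hodge substructures. -/
def Indecomposable (S : PolarisedHodgeStructure L) : Prop :=
  Nontrivial L ∧ ∀ L₁ L₂ : Submodule ℤ L, S.IsOrthogonalDecomposition L₁ L₂ → L₁ = ⊥ ∨ L₂ = ⊥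

/-! The orthogonal product of a finite family -/

variable {ι : Type*} [Fintype ι] [DecidableEq ι] {P : ι → Type*} [∀ i, AddCommGroup (P i)]
  [∀ i, Module.Free ℤ (P i)] [∀ i, Module.Finite ℤ (P i)]

/-- The product `∏ᵢ (Lᵢ, ψᵢ, hᵢ)` of a finite family: the lattice is `∏ᵢ Lᵢ`, the subspace of
type `(p, q)` is `∏ᵢ Lᵢ^{p,q}`, and `ψ(x, y) = ∑ᵢ ψᵢ(xᵢ, yᵢ)`. -/
def prod (T : ∀ i, PolarisedHodgeStructure (P i)) : PolarisedHodgeStructure (∀ i, P i) where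
  comp := prodComp fun i => (T i).toHodgeDecomposition
  isInternal := prodComp_isInternal _
  conj_comp := prodComp_conj _
  lattice_isInternal := by
    refine isInternal_of_proj (fun i => LinearMap.proj i) (fun i => LinearMap.single ℤ P i)
      (fun x => by ext i; simp) (fun i n => (T i).latticeWeight n)
      (fun i => (T i).lattice_isInternal) _ (fun n x => ?_) ?_
    · exact mem_latticeWeight_prodDecomposition _ n x
    · intro i n x hx
      refine (mem_latticeWeight_prodDecomposition _ n _).2 fun j => ?_
      by_cases hij : j = i
      · subst hij; simpa using hx
      · simp [hij]
  ψ := prodPairing fun i => (T i).ψ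
  ψ_of_ne := by
    intro m n hmn x hx y hy
    rw [prodPairing_apply]
    refine Finset.sum_eq_zero fun i _ => (T i).ψ_of_ne m n hmn _ ?_ _ ?_
    · exact (mem_latticeWeight_prodDecomposition _ m x).1 hx i
    · exact (mem_latticeWeight_prodDecomposition _ n y).1 hy i
  ψ_weight := by
    intro n x hx y hy k hk
    rw [prodPairing_apply, DFinsupp.finsetSum_apply]
    refine Finset.sum_eq_zero fun i _ => (T i).ψ_weight n _ ?_ _ ?_ k hk
    · exact (mem_latticeWeight_prodDecomposition _ n x).1 hx i
    · exact (mem_latticeWeight_prodDecomposition _ n y).1 hy i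
  ψ_equivariant := by
    intro n x hx y hy z
    rw [realPairing_prod, realPairing_prod, Finset.mul_sum]
    refine Finset.sum_congr rfl fun i _ => ?_
    rw [← (T i).ψ_equivariant n _ ((mem_weight_prodDecomposition _ n x).1 hx i) _
      ((mem_weight_prodDecomposition _ n y).1 hy i) z]
    rw [proj_h_prodDecomposition, proj_h_prodDecomposition]
  φ_symm := by
    intro n x hx y hy
    rw [realPairing_prod, realPairing_prod, Finset.mul_sum, Finset.mul_sum]
    refine Finset.sum_congr rfl fun i _ => ?_
    rw [proj_h_prodDecomposition, proj_h_prodDecomposition]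
    exact (T i).φ_symm n _ ((mem_weight_prodDecomposition _ n x).1 hx i) _
      ((mem_weight_prodDecomposition _ n y).1 hy i)
  φ_pos := by
    intro n x hx hx0
    rw [realPairing_prod, Finset.mul_sum]
    simp only [proj_h_prodDecomposition]
    obtain ⟨i, hi⟩ : ∃ i, (LinearMap.proj i : (∀ i, P i) →ₗ[ℤ] P i).baseChange ℝ x ≠ 0 := by
      by_contra! h0
      exact hx0 (by rw [← sum_single_proj_real x]; simp [h0])
    refine Finset.sum_pos' (fun j _ => ?_) ⟨i, Finset.mem_univ i, ?_⟩
    · by_cases hj : (LinearMap.proj j : (∀ i, P i) →ₗ[ℤ] P j).baseChange ℝ x = 0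
      · simp [hj]
      · exact ((T j).φ_pos n _ ((mem_weight_prodDecomposition _ n x).1 hx j) hj).le
    · exact (T i).φ_pos n _ ((mem_weight_prodDecomposition _ n x).1 hx i) hi

end PolarisedHodgeStructure

end

/-! The decomposition into indecomposables is unique not only up to isomorphism but as a set of
sublattices (Eichler's theorem for positive definite lattices), so every automorphism permutes the
factors. A factor can only go to an isomorphic one, which leaves exactly the monomial maps:
automorphisms of the factors combined with permutations of the equal ones.

Uniqueness is proved with projections. A summand corresponds to an idempotent Hodge endomorphism
that is self-adjoint for `ψ`. The main point is that any two of these, `e` and `f`, commute. This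
fails in a Euclidean space and comes from integrality: `efe` does not increase norms, a lattice has
finitely many vectors of bounded norm, so the iterates of `efe` become stationary; being
self-adjoint, `efe` is then idempotent, and this forces `ef = fe`
(`commute_of_selfAdjoint_of_idempotent`). It is applied in each weight to the positive definite form
`φ`.

If `f` commutes with the projection onto an indecomposable factor, its compression to that factor is
again an orthogonal projection, hence `0` or the identity (`Indecomposable.coordProj_comp_eq`).
Taking for `f` the conjugates of coordinate projections by an automorphism shows that the factors
are permuted (`IsIsomorphism.exists_coordProj_comm`). -/

/-! ### Lattices in Euclidean spaces -/

/-- A lattice has only finitely many vectors of bounded norm. -/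
theorem finite_setOf_apply_self_le {M : Type*} [AddCommGroup M] [Module.Free ℤ M]
    [Module.Finite ℤ M] (B : LinearMap.BilinForm ℝ (ℝ ⊗[ℤ] M)) (hsymm : LinearMap.IsSymm B)
    (hpos : ∀ x, x ≠ 0 → 0 < B x x) (c : ℝ) :
    {x : M | B (1 ⊗ₜ x) (1 ⊗ₜ x) ≤ c}.Finite := by
  have hnonneg : ∀ x, 0 ≤ B x x := fun x => by
    by_cases hx : x = 0
    · simp [hx]
    · exact (hpos x hx).le
  have hinj : Function.Injective B := by
    refine (injective_iff_map_eq_zero B).2 fun x hx => ?_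
    by_contra h0
    have := hpos x h0
    simp [hx] at this
  have hsurj : Function.Surjective B :=
    (LinearMap.injective_iff_surjective_of_finrank_eq_finrank
      Subspace.dual_finrank_eq.symm).1 hinj
  let b := Module.Free.chooseBasis ℤ M
  -- `B` is nondegenerate, so each coordinate function is `B (w i)` for some vector `w i`.
  -- Cauchy–Schwarz then bounds the coordinates of `x`, which confines `x` to a finite box.
  choose w hw using fun i => hsurj ((b.baseChange ℝ).coord i)
  have hcoord : ∀ i x, (b.repr x i : ℝ) = B (w i) (1 ⊗ₜ x) := fun i x => by
    rw [hw]
    simp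
  have hfin : (Set.univ.pi fun i => {k : ℤ | |k| ≤ ⌈B (w i) (w i) * c⌉}).Finite := by
    refine Set.Finite.pi fun i => (Set.finite_Icc (-⌈B (w i) (w i) * c⌉)
      ⌈B (w i) (w i) * c⌉).subset fun k hk => ?_
    exact abs_le.1 hk
  refine (hfin.preimage (f := fun x : M => (b.repr x : _ → ℤ))
    (fun x _ y _ hxy => b.repr.injective (DFunLike.coe_injective hxy))).subset ?_
  intro x hx i _
  have h1 : B (w i) (1 ⊗ₜ x) ^ 2 ≤ B (w i) (w i) * c :=
    (B.apply_sq_le_of_symm hnonneg hsymm _ _).trans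
      (mul_le_mul_of_nonneg_left hx (hnonneg _))
  rw [← hcoord] at h1
  have h2 : (b.repr x i) ^ 2 ≤ ⌈B (w i) (w i) * c⌉ := by
    have := h1.trans (Int.le_ceil _)
    exact_mod_cast this
  -- For an integer the absolute value is at most the square, so no square root is needed in the
  -- size of the box.
  have h3 : |b.repr x i| ≤ (b.repr x i) ^ 2 := by
    rw [← sq_abs]
    exact Int.le_self_sq _
  exact h3.trans h2

/-- In a lattice, any two self-adjoint idempotents commute. -/
theorem commute_of_selfAdjoint_of_idempotent {M : Type*} [AddCommGroup M]
    (C : M →+ M →+ ℝ) (hsymm : ∀ x y, C x y = C y x) (hpos : ∀ x, x ≠ 0 → 0 < C x x)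
    (hfin : ∀ c, {x | C x x ≤ c}.Finite) (e f : M →+ M)
    (he : ∀ x, e (e x) = e x) (hf : ∀ x, f (f x) = f x)
    (he' : ∀ x y, C (e x) y = C x (e y)) (hf' : ∀ x y, C (f x) y = C x (f y)) (x : M) :
    e (f x) = f (e x) := by
  have hzero : ∀ x, C x x ≤ 0 → x = 0 := fun x hx => by
    by_contra h0
    exact (hpos x h0).not_ge hx
  have hnonneg : ∀ x, 0 ≤ C x x := fun x => by
    by_cases hx : x = 0
    · simp [hx]
    · exact (hpos x hx).le
  have pyth : ∀ p : M →+ M, (∀ x, p (p x) = p x) → (∀ x y, C (p x) y = C x (p y)) →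
      ∀ x, C x x = C (p x) (p x) + C (x - p x) (x - p x) := by
    intro p hp hp' x
    have h1 : C (p x) (p x) = C x (p x) := by rw [hp', hp]
    have h2 : C (p x) x = C x (p x) := hp' x x
    simp only [map_sub, AddMonoidHom.sub_apply, h1, h2]
    ring
  have hle : ∀ p : M →+ M, (∀ x, p (p x) = p x) → (∀ x y, C (p x) y = C x (p y)) →
      ∀ x, C (p x) (p x) ≤ C x x := fun p hp hp' x => by
    linarith [pyth p hp hp' x, hnonneg (x - p x)]
  -- Equality of norms in Pythagoras leaves `x - p x` with norm zero.
  have hfix : ∀ p : M →+ M, (∀ x, p (p x) = p x) → (∀ x y, C (p x) y = C x (p y)) →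
      ∀ x, C x x ≤ C (p x) (p x) → p x = x := fun p hp hp' x hx =>
    (sub_eq_zero.1 (hzero _ (by linarith [pyth p hp hp' x]))).symm
  let g : M →+ M := e.comp (f.comp e)
  have hg : ∀ x, g x = e (f (e x)) := fun _ => rfl
  have hg' : ∀ x y, C (g x) y = C x (g y) := fun x y => by simp only [hg, he', hf']
  have hgle : ∀ x, C (g x) (g x) ≤ C x x := fun x =>
    ((hle e he he' _).trans (hle f hf hf' _)).trans (hle e he he' x)
  have hgfix : ∀ x, C x x ≤ C (g x) (g x) → g x = x := fun x hx => by
    have h1 : e x = x := hfix e he he' x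
      (hx.trans ((hle e he he' _).trans (hle f hf hf' _)))
    have h2 : f x = x := by
      refine hfix f hf hf' x ?_
      have : C x x ≤ C (f (e x)) (f (e x)) := hx.trans (hle e he he' _)
      rwa [h1] at this
    rw [hg, h1, h2, h1]
  have hanti : ∀ x, Antitone fun k => C (g^[k] x) (g^[k] x) := fun x =>
    antitone_nat_of_succ_le fun k => by
      rw [Function.iterate_succ_apply']
      exact hgle _
  -- The norms of the iterates decrease and the iterates lie in a finite set, so two of them
  -- coincide. The norm is constant between these two, and `g` fixes any vector whose norm it
  -- preserves.
  have hidem : ∀ x, g (g x) = g x := fun x => by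
    obtain ⟨k, m, hkm, heq⟩ := (hfin (C x x)).exists_lt_map_eq_of_forall_mem
      (f := fun k => g^[k] x) fun k => hanti x (Nat.zero_le k)
    have hk : g (g^[k] x) = g^[k] x := by
      refine hgfix _ ?_
      have h1 := hanti x (Nat.succ_le_of_lt hkm)
      simp only [Function.iterate_succ_apply'] at h1
      rwa [← heq] at h1
    -- A self-adjoint map has no nilpotent part: `C (g v) (g v) = C v (g (g v))`. Applied to `u = g
    -- x - x`, which `g^[k]` kills, this gives `g (g x) = g x`.
    have hnil : ∀ k u, g (g^[k] u) = 0 → g u = 0 := by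
      intro k
      induction k with
      | zero => exact fun u hu => hu
      | succ k ih =>
        intro u hu
        rw [Function.iterate_succ_apply'] at hu
        refine ih u (hzero _ ?_)
        rw [hg', hu, map_zero]
    have h0 := hnil k (g x - x) (by
      rw [iterate_map_sub, ← Function.iterate_succ_apply, Function.iterate_succ_apply', hk,
        sub_self, map_zero])
    rwa [map_sub, sub_eq_zero] at h0
  -- Both `f (e x)` and its image `g x` under `e` have norm `C (g x) x`: the first because `f` is
  -- idempotent, the second because `g` is. So `e` fixes `f (e x)`.
  have hfe : ∀ x, f (e x) = e (f (e x)) := fun x => by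
    refine (hfix e he he' _ ?_).symm
    have h1 : C (f (e x)) (f (e x)) = C (g x) x := by
      rw [hg, he', hf', hf, hf']
    have h2 : C (g x) (g x) = C (g x) x := by
      rw [hg' x (g x), hidem, hsymm]
    rw [h1, ← h2, hg]
  -- This is the adjoint of the identity `fe = efe`; the form is nondegenerate.
  have hef : ∀ x, e (f x) = e (f (e x)) := fun x => by
    refine sub_eq_zero.1 (hzero _ (le_of_eq ?_))
    have h : ∀ y, C (e (f x) - e (f (e x))) y = 0 := fun y => by
      rw [map_sub, AddMonoidHom.sub_apply, he', hf', he', hf', he', ← hfe, sub_self]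
    exact h _
  rw [hef, ← hfe]

/-! ### Orthogonal projections of polarised Hodge structures -/

namespace PolarisedHodgeStructure

variable {L : Type*} [AddCommGroup L] [Module.Free ℤ L] [Module.Finite ℤ L]
variable {L' : Type*} [AddCommGroup L'] [Module.Free ℤ L'] [Module.Finite ℤ L']

theorem _root_.IntegralHodgeStructure.IsHodgeMorphism.comp {L'' : Type*} [AddCommGroup L'']
    [Module.Free ℤ L''] [Module.Finite ℤ L''] {S : IntegralHodgeStructure L}
    {S' : IntegralHodgeStructure L'} {S'' : IntegralHodgeStructure L''} {g : L' →ₗ[ℤ] L''}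
    {f : L →ₗ[ℤ] L'} (hg : S'.IsHodgeMorphism S'' g) (hf : S.IsHodgeMorphism S' f) :
    S.IsHodgeMorphism S'' (g ∘ₗ f) := fun pq v hv => by
  rw [LinearMap.baseChange_comp, LinearMap.baseChange_comp]
  exact hg pq _ (hf pq v hv)

/-- An endomorphism of Hodge structures that is a projection, self-adjoint for `ψ`. -/
structure IsOrthogonalProjection (S : PolarisedHodgeStructure L) (e : L →ₗ[ℤ] L) : Prop where
  idem : ∀ x, e (e x) = e x
  hodge : S.IsHodgeMorphism S.toIntegralHodgeStructure e
  adj : ∀ x y, S.ψ (e x) y = S.ψ x (e y)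

theorem realPairing_adj {S : PolarisedHodgeStructure L} {e : L →ₗ[ℤ] L}
    (he : ∀ x y, S.ψ (e x) y = S.ψ x (e y)) (n : ℤ) (x y : ℝ ⊗[ℤ] L) :
    realPairing S.ψ n (e.baseChange ℝ x) y = realPairing S.ψ n x (e.baseChange ℝ y) := by
  induction x with
  | zero => simp
  | add x x' hx hx' => simp only [map_add, LinearMap.add_apply, hx, hx']
  | tmul a x =>
    induction y with
    | zero => simp
    | add y y' hy hy' => simp only [map_add, hy, hy']
    | tmul b y => simp only [LinearMap.baseChange_tmul, realPairing_tmul, he]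

/-- The real part of the form `φ(x, y) = (2πi)^n ψ_ℝ(x, h(i)y)` on `L_ℝ`. -/
noncomputable def reForm (S : PolarisedHodgeStructure L) (n : ℤ) :
    LinearMap.BilinForm ℝ (ℝ ⊗[ℤ] L) :=
  ((realPairing S.ψ n).compl₂ (S.h (Units.mk0 Complex.I Complex.I_ne_zero))).compr₂
    (Complex.reLm ∘ₗ LinearMap.mulLeft ℝ ((2 * Real.pi * Complex.I : ℂ) ^ n))

theorem reForm_apply (S : PolarisedHodgeStructure L) (n : ℤ) (x y : ℝ ⊗[ℤ] L) :
    S.reForm n x y = ((2 * Real.pi * Complex.I : ℂ) ^ n *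
      realPairing S.ψ n x (S.h (Units.mk0 Complex.I Complex.I_ne_zero) y)).re := rfl

/-- The form involves `h(i)`, so self-adjointness for `ψ` is combined with commutation with `h`. -/
theorem IsOrthogonalProjection.reForm_adj {S : PolarisedHodgeStructure L} {e : L →ₗ[ℤ] L}
    (he : S.IsOrthogonalProjection e) (n : ℤ) (x y : ℝ ⊗[ℤ] L) :
    S.reForm n (e.baseChange ℝ x) y = S.reForm n x (e.baseChange ℝ y) := by
  rw [reForm_apply, reForm_apply, realPairing_adj he.adj,
    HodgeDecomposition.h_comm S.toHodgeDecomposition S.toHodgeDecomposition _ he.hodge]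

theorem mem_latticeWeight_of_isHodgeMorphism {S : PolarisedHodgeStructure L} {e : L →ₗ[ℤ] L}
    (he : S.IsHodgeMorphism S.toIntegralHodgeStructure e) {n : ℤ} {x : L}
    (hx : x ∈ S.latticeWeight n) : e x ∈ S.latticeWeight n := by
  have := HodgeDecomposition.map_weight S.toHodgeDecomposition S.toHodgeDecomposition _ he n _ hx
  rwa [LinearMap.baseChange_tmul] at this

/-- Symmetry and positivity of `φ` are given only on `(L_ℝ)^n`; this inclusion lets them be pulled
back to `ℝ ⊗ L^n`. -/
theorem baseChange_subtype_mem_weight (S : PolarisedHodgeStructure L) (n : ℤ)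
    (x : ℝ ⊗[ℤ] S.latticeWeight n) :
    (S.latticeWeight n).subtype.baseChange ℝ x ∈ S.weight n := by
  induction x with
  | zero => simp
  | add x y hx hy => rw [map_add]; exact add_mem hx hy
  | tmul a x =>
    have h : (1 : ℝ) ⊗ₜ[ℤ] (x : L) ∈ S.weight n := x.2
    have := (S.weight n).smul_mem a h
    rwa [TensorProduct.smul_tmul', smul_eq_mul, mul_one] at this

/-- Orthogonal projections of a polarised integral Hodge structure commute. -/
theorem IsOrthogonalProjection.commute {S : PolarisedHodgeStructure L} {e f : L →ₗ[ℤ] L}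
    (he : S.IsOrthogonalProjection e) (hf : S.IsOrthogonalProjection f) (x : L) :
    e (f x) = f (e x) := by
  have hx : x ∈ ⨆ n, S.latticeWeight n := by
    rw [S.lattice_isInternal.submodule_iSup_eq_top]; trivial
  induction hx using Submodule.iSup_induction' with
  | zero => simp
  | add x y _ _ hx hy => simp only [map_add, hx, hy]
  -- Hodge endomorphisms preserve weights, so the question reduces to the lattice `L^n` with the
  -- pullback of `φ`.
  | mem n x hx =>
    have hinj : Function.Injective ((S.latticeWeight n).subtype.baseChange ℝ) :=
      Module.Flat.lTensor_preserves_injective_linearMap _ (Submodule.injective_subtype _)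
    let B : LinearMap.BilinForm ℝ (ℝ ⊗[ℤ] S.latticeWeight n) :=
      (S.reForm n).compl₁₂ ((S.latticeWeight n).subtype.baseChange ℝ)
        ((S.latticeWeight n).subtype.baseChange ℝ)
    have hB : ∀ x y, B x y = S.reForm n ((S.latticeWeight n).subtype.baseChange ℝ x)
      ((S.latticeWeight n).subtype.baseChange ℝ y) := fun _ _ => rfl
    have hsymm : ∀ x y, B x y = B y x := fun x y =>
      congrArg Complex.re (S.φ_symm n _ (S.baseChange_subtype_mem_weight n x) _
        (S.baseChange_subtype_mem_weight n y))
    have hpos : ∀ x, x ≠ 0 → 0 < B x x := fun x hx =>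
      (Complex.pos_iff.1 (S.φ_pos n _ (S.baseChange_subtype_mem_weight n x)
        ((map_ne_zero_iff _ hinj).2 hx))).1
    let C : S.latticeWeight n →+ S.latticeWeight n →+ ℝ :=
      AddMonoidHom.mk' (fun x => AddMonoidHom.mk' (fun y => B (1 ⊗ₜ x) (1 ⊗ₜ y))
        fun y y' => by rw [TensorProduct.tmul_add, map_add])
        fun x x' => by ext y; simp [TensorProduct.tmul_add]
    have hC : ∀ x y, C x y = B (1 ⊗ₜ x) (1 ⊗ₜ y) := fun _ _ => rfl
    -- Flatness of `L^n` embeds it in its real span, so that positivity of `B` passes to lattice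
    -- vectors.
    have hone : Function.Injective fun x : S.latticeWeight n => (1 : ℝ) ⊗ₜ[ℤ] x := by
      have := Module.Flat.rTensor_preserves_injective_linearMap (M := S.latticeWeight n)
        (Algebra.linearMap ℤ ℝ) Int.cast_injective
      intro x y hxy
      have h2 := @this (1 ⊗ₜ x) (1 ⊗ₜ y) (by simpa using hxy)
      simpa using congrArg (TensorProduct.lid ℤ _) h2
    have hmem : ∀ {p : L →ₗ[ℤ] L}, S.IsOrthogonalProjection p →
        ∀ x ∈ S.latticeWeight n, p x ∈ S.latticeWeight n :=
      fun hp x hx => mem_latticeWeight_of_isHodgeMorphism hp.hodge hx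
    have hadj : ∀ {p : L →ₗ[ℤ] L} (hp : S.IsOrthogonalProjection p) (x y : S.latticeWeight n),
        C (p.restrict (hmem hp) x) y = C x (p.restrict (hmem hp) y) := fun hp x y => by
      have := hp.reForm_adj n (1 ⊗ₜ (x : L)) (1 ⊗ₜ (y : L))
      simp only [LinearMap.baseChange_tmul] at this
      simpa only [hC, hB, LinearMap.baseChange_tmul, Submodule.subtype_apply,
        LinearMap.coe_restrict_apply] using this
    have := commute_of_selfAdjoint_of_idempotent C (fun _ _ => hsymm _ _)
      (fun x hx => hpos _ fun h0 => hx (hone (by simpa using h0)))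
      (finite_setOf_apply_self_le B ⟨hsymm⟩ hpos)
      (e.restrict (hmem he)).toAddMonoidHom (f.restrict (hmem hf)).toAddMonoidHom
      (fun x => Subtype.ext (he.idem x)) (fun x => Subtype.ext (hf.idem x))
      (hadj he) (hadj hf) ⟨x, hx⟩
    exact congrArg Subtype.val this

/-- An orthogonal projection of an indecomposable polarised Hodge structure is trivial. -/
theorem Indecomposable.eq_zero_or_eq_id {S : PolarisedHodgeStructure L} (hS : S.Indecomposable)
    {u : L →ₗ[ℤ] L} (hu : S.IsOrthogonalProjection u) : u = 0 ∨ u = LinearMap.id := by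
  have hsub : ∀ {p : L →ₗ[ℤ] L}, S.IsHodgeMorphism S.toIntegralHodgeStructure p →
      S.IsHodgeSubstructure (LinearMap.range p) := by
    intro p hp z x hx
    -- The surjection of `L` onto the image of `p` stays surjective over `ℝ`, so the real span of
    -- the image is the image of the real extension, which `h` preserves.
    have hrange : (LinearMap.range p).baseChange ℝ = LinearMap.range (p.baseChange ℝ) := by
      have hp' : p.baseChange ℝ =
          (LinearMap.range p).subtype.baseChange ℝ ∘ₗ p.rangeRestrict.baseChange ℝ := by
        rw [← LinearMap.baseChange_comp]
        rfl
      have hsurj : Function.Surjective (p.rangeRestrict.baseChange ℝ) :=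
        LinearMap.lTensor_surjective ℝ p.surjective_rangeRestrict
      rw [hp', LinearMap.range_comp_of_range_eq_top _ (LinearMap.range_eq_top.2 hsurj)]
      rfl
    rw [hrange] at hx ⊢
    obtain ⟨y, rfl⟩ := hx
    exact ⟨S.h z y, HodgeDecomposition.h_comm S.toHodgeDecomposition S.toHodgeDecomposition _
      hp z y⟩
  -- The kernel is the image of the complementary projection, so the argument for images also makes
  -- it a Hodge substructure.
  have hker : LinearMap.range (LinearMap.id - u) = LinearMap.ker u := by
    ext x
    constructor
    · rintro ⟨y, rfl⟩
      simp [hu.idem]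
    · intro hx
      exact ⟨x, by simp [LinearMap.mem_ker.1 hx]⟩
  have hid : S.IsHodgeMorphism S.toIntegralHodgeStructure (LinearMap.id - u) := by
    intro pq v hv
    rw [LinearMap.baseChange_sub, LinearMap.baseChange_sub, LinearMap.sub_apply]
    exact sub_mem (S.isMorphism_id.1 pq v hv) (hu.hodge pq v hv)
  have hdec : S.IsOrthogonalDecomposition (LinearMap.range u) (LinearMap.ker u) := by
    refine ⟨hsub hu.hodge, hker ▸ hsub hid, ?_, ?_, ?_⟩
    · rw [isCompl_iff, disjoint_iff, codisjoint_iff, eq_bot_iff, eq_top_iff]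
      refine ⟨?_, fun x _ => ?_⟩
      · rintro _ ⟨⟨y, rfl⟩, hy⟩
        rw [Submodule.mem_bot, ← hu.idem]
        exact hy
      · rw [← add_sub_cancel (u x) x]
        refine Submodule.add_mem_sup ⟨x, rfl⟩ ?_
        simp [hu.idem]
    · rintro _ ⟨x, rfl⟩ y hy
      rw [hu.adj, LinearMap.mem_ker.1 hy, map_zero]
    · rintro x hx _ ⟨y, rfl⟩
      rw [← hu.adj, LinearMap.mem_ker.1 hx, map_zero, LinearMap.zero_apply]
  rcases hS.2 _ _ hdec with h | h
  · exact Or.inl (LinearMap.range_eq_bot.1 h)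
  · refine Or.inr (LinearMap.ext fun x => ?_)
    exact LinearMap.ker_eq_bot.1 h (hu.idem x)

/-! ### Transport along isomorphisms -/

theorem IsIsomorphism.symm {S : PolarisedHodgeStructure L} {S' : PolarisedHodgeStructure L'}
    {σ : L ≃ₗ[ℤ] L'} (hσ : S.IsIsomorphism S' σ) : S'.IsIsomorphism S σ.symm :=
  ⟨hσ.2, hσ.1⟩

theorem IsIsomorphism.trans {L'' : Type*} [AddCommGroup L''] [Module.Free ℤ L'']
    [Module.Finite ℤ L''] {S : PolarisedHodgeStructure L} {S' : PolarisedHodgeStructure L'}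
    {S'' : PolarisedHodgeStructure L''} {σ : L ≃ₗ[ℤ] L'} {τ : L' ≃ₗ[ℤ] L''}
    (hσ : S.IsIsomorphism S' σ) (hτ : S'.IsIsomorphism S'' τ) :
    S.IsIsomorphism S'' (σ.trans τ) := by
  have h1 : S.IsMorphism S'' (τ.toLinearMap ∘ₗ σ.toLinearMap) := hτ.1.comp hσ.1
  have h2 : S''.IsMorphism S (σ.symm.toLinearMap ∘ₗ τ.symm.toLinearMap) := hσ.2.comp hτ.2
  exact And.intro h1 h2

/-- An isomorphism of polarised Hodge structures transports automorphisms. -/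
noncomputable def IsIsomorphism.autCongr {S : PolarisedHodgeStructure L}
    {S' : PolarisedHodgeStructure L'} {σ : L ≃ₗ[ℤ] L'} (hσ : S.IsIsomorphism S' σ) :
    S.Aut ≃* S'.Aut where
  toFun a := ⟨σ.symm.trans (a.1.trans σ), hσ.symm.trans (IsIsomorphism.trans a.2 hσ)⟩
  invFun a := ⟨σ.trans (a.1.trans σ.symm), hσ.trans (IsIsomorphism.trans a.2 hσ.symm)⟩
  left_inv a := by ext x; simp
  right_inv a := by ext x; simp
  map_mul' a b := by ext x; simp

/-- An isomorphism preserves the pairings, so its adjoint is its inverse and conjugation respects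
self-adjointness. -/
theorem IsOrthogonalProjection.conj {S : PolarisedHodgeStructure L}
    {S' : PolarisedHodgeStructure L'} {σ : L ≃ₗ[ℤ] L'} (hσ : S.IsIsomorphism S' σ)
    {e : L →ₗ[ℤ] L} (he : S.IsOrthogonalProjection e) :
    S'.IsOrthogonalProjection (σ.toLinearMap ∘ₗ e ∘ₗ σ.symm.toLinearMap) where
  idem x := by simp [he.idem]
  hodge := hσ.1.1.comp (he.hodge.comp hσ.2.1)
  adj x y := by
    have h : ∀ x y, S'.ψ (σ x) y = S.ψ x (σ.symm y) := fun x y => by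
      have := hσ.1.2 x (σ.symm y)
      simpa using this
    have h' : ∀ x y, S'.ψ x (σ y) = S.ψ (σ.symm x) y := fun x y => by
      have := hσ.1.2 (σ.symm x) y
      simpa using this
    simp [h, h', he.adj]

/-! ### Products -/

section Coordinates

variable {ι : Type*} [DecidableEq ι] {P : ι → Type*} [∀ i, AddCommGroup (P i)]

/-- The projection of a product onto one of its factors, as an endomorphism of the product. -/
def coordProj (s : ι) : (∀ i, P i) →ₗ[ℤ] ∀ i, P i :=
  LinearMap.single ℤ P s ∘ₗ LinearMap.proj s

theorem coordProj_apply (s : ι) (x : ∀ i, P i) : coordProj s x = Pi.single s (x s) := rfl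

theorem coordProj_single (s : ι) (x : P s) :
    coordProj s (Pi.single s x : ∀ i, P i) = Pi.single s x := by
  simp [coordProj_apply]

theorem sum_coordProj [Fintype ι] (x : ∀ i, P i) : ∑ s, coordProj s x = x := by
  simp only [coordProj_apply]
  exact Finset.univ_sum_single x

variable {σ : (∀ i, P i) ≃ₗ[ℤ] ∀ i, P i} {s t : ι}

/-- The intertwining relation says that `σ` carries factor `t` into factor `s`, so nothing is lost
by keeping only the coordinate `s`. -/
theorem single_apply_of_coordProj_comm (h : ∀ x, σ (coordProj t x) = coordProj s (σ x))
    (x : P t) : Pi.single s (σ (Pi.single t x) s) = σ (Pi.single t x) := by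
  rw [← coordProj_apply, ← h, coordProj_single]

theorem coordProj_comm_symm (h : ∀ x, σ (coordProj t x) = coordProj s (σ x)) (x : ∀ i, P i) :
    σ.symm (coordProj s x) = coordProj t (σ.symm x) := by
  rw [LinearEquiv.symm_apply_eq, h, LinearEquiv.apply_symm_apply]

/-- The isomorphism between two factors of a product induced by an automorphism that carries the
first one to the second one. -/
def blockEquiv (σ : (∀ i, P i) ≃ₗ[ℤ] ∀ i, P i)
    (h : ∀ x, σ (coordProj t x) = coordProj s (σ x)) : P t ≃ₗ[ℤ] P s :=
  LinearEquiv.ofLinearMap (LinearMap.proj s ∘ₗ σ.toLinearMap ∘ₗ LinearMap.single ℤ P t)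
    (LinearMap.proj t ∘ₗ σ.symm.toLinearMap ∘ₗ LinearMap.single ℤ P s)
    (LinearMap.ext fun x => by
      simp [single_apply_of_coordProj_comm (σ := σ.symm) (coordProj_comm_symm h) x])
    (LinearMap.ext fun x => by simp [single_apply_of_coordProj_comm h x])

end Coordinates

/-! ### Coordinate projections of a product of Hodge structures -/

variable {ι : Type*} [Fintype ι] [DecidableEq ι] {P : ι → Type*} [∀ i, AddCommGroup (P i)]
  [∀ i, Module.Free ℤ (P i)] [∀ i, Module.Finite ℤ (P i)]
  {T : ∀ i, PolarisedHodgeStructure (P i)}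

theorem prod_ψ_apply (T : ∀ i, PolarisedHodgeStructure (P i)) (x y : ∀ i, P i) :
    (prod T).ψ x y = ∑ i, (T i).ψ (x i) (y i) :=
  prodPairing_apply _ x y

theorem prod_ψ_single_left (T : ∀ i, PolarisedHodgeStructure (P i)) (s : ι) (x : P s)
    (y : ∀ i, P i) : (prod T).ψ (Pi.single s x) y = (T s).ψ x (y s) := by
  rw [prod_ψ_apply, Finset.sum_eq_single s]
  · simp
  · intro i _ hi
    simp [hi]
  · simp

theorem prod_ψ_single_right (T : ∀ i, PolarisedHodgeStructure (P i)) (s : ι) (x : ∀ i, P i)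
    (y : P s) : (prod T).ψ x (Pi.single s y) = (T s).ψ (x s) y := by
  rw [prod_ψ_apply, Finset.sum_eq_single s]
  · simp
  · intro i _ hi
    simp [hi]
  · simp

theorem isHodgeMorphism_proj (T : ∀ i, PolarisedHodgeStructure (P i)) (s : ι) :
    (prod T).IsHodgeMorphism (T s).toIntegralHodgeStructure (LinearMap.proj s) :=
  fun _ _ hv => (Submodule.mem_iInf _).1 hv s

theorem isMorphism_single (T : ∀ i, PolarisedHodgeStructure (P i)) (s : ι) :
    (T s).IsMorphism (prod T) (LinearMap.single ℤ P s) :=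
  ⟨fun pq v hv => single_mem_prodComp _ s pq v hv, fun x y => by
    simp [prod_ψ_single_left]⟩

theorem isHodgeMorphism_prod {S : PolarisedHodgeStructure L} {f : L →ₗ[ℤ] ∀ i, P i}
    (hf : ∀ i, S.IsHodgeMorphism (T i).toIntegralHodgeStructure (LinearMap.proj i ∘ₗ f)) :
    S.IsHodgeMorphism (prod T).toIntegralHodgeStructure f := by
  intro pq v hv
  refine (Submodule.mem_iInf _).2 fun i => ?_
  have := hf i pq v hv
  rwa [LinearMap.baseChange_comp, LinearMap.baseChange_comp] at this

theorem isOrthogonalProjection_coordProj (T : ∀ i, PolarisedHodgeStructure (P i)) (s : ι) :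
    (prod T).IsOrthogonalProjection (coordProj s) where
  idem x := by simp [coordProj_apply]
  hodge := (isMorphism_single T s).1.comp (isHodgeMorphism_proj T s)
  adj x y := by rw [coordProj_apply, coordProj_apply, prod_ψ_single_left, prod_ψ_single_right]

/-- The compression of `f` to the factor `s` is idempotent because `f` commutes with `coordProj s`;
indecomposability then leaves only `0` and the identity. -/
theorem Indecomposable.coordProj_comp_eq {s : ι} (hs : (T s).Indecomposable)
    {f : (∀ i, P i) →ₗ[ℤ] ∀ i, P i} (hf : (prod T).IsOrthogonalProjection f) :
    (∀ x, coordProj s (f x) = 0) ∨ ∀ x, coordProj s (f x) = coordProj s x := by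
  have hcomm := (isOrthogonalProjection_coordProj T s).commute hf
  have hu : (T s).IsOrthogonalProjection (LinearMap.proj s ∘ₗ f ∘ₗ LinearMap.single ℤ P s) := by
    refine ⟨fun x => ?_, (isHodgeMorphism_proj T s).comp (hf.hodge.comp (isMorphism_single T s).1),
      fun x y => ?_⟩
    · have h := congrFun (hf.idem (Pi.single s x)) s
      have h2 := hcomm (Pi.single s x)
      rw [coordProj_single, coordProj_apply] at h2
      simpa [h2] using h
    · have := hf.adj (Pi.single s x) (Pi.single s y)
      rw [prod_ψ_single_left, prod_ψ_single_right] at this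
      simpa using this
  -- By commutation, `coordProj s ∘ f` depends only on the coordinate `s` and is determined by the
  -- compression.
  have key : ∀ x, coordProj s (f x) =
      Pi.single s ((LinearMap.proj s ∘ₗ f ∘ₗ LinearMap.single ℤ P s) (x s)) := fun x => by
    have h1 : coordProj s (coordProj s (f x)) = coordProj s (f (coordProj s x)) := by
      rw [hcomm]
    rw [(isOrthogonalProjection_coordProj T s).idem] at h1
    rw [h1]
    simp [coordProj_apply]
  rcases hs.eq_zero_or_eq_id hu with h | h
  · exact Or.inl fun x => by simp [key, h]
  · exact Or.inr fun x => by simp [key, h, coordProj_apply]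

/-- An automorphism of a product of indecomposable polarised Hodge structures permutes the
factors. -/
theorem IsIsomorphism.exists_coordProj_comm (hT : ∀ i, (T i).Indecomposable)
    {σ : (∀ i, P i) ≃ₗ[ℤ] ∀ i, P i} (hσ : (prod T).IsIsomorphism (prod T) σ) (t : ι) :
    ∃ s, ∀ x, σ (coordProj t x) = coordProj s (σ x) := by
  have hf := (isOrthogonalProjection_coordProj T t).conj hσ
  -- The factor `t` is nonzero, so its image under `σ` has a nonzero component in some factor `s`.
  obtain ⟨s, x, hx⟩ : ∃ s x, coordProj s (σ (coordProj t (σ.symm x))) ≠ 0 := by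
    by_contra! h
    have := (hT t).1
    obtain ⟨y, hy⟩ := exists_ne (0 : P t)
    apply hy
    have h0 : σ (Pi.single t y) = 0 := by
      rw [← sum_coordProj (σ (Pi.single t y))]
      refine Finset.sum_eq_zero fun s _ => ?_
      simpa [coordProj_single] using h s (σ (Pi.single t y))
    simpa using h0
  have h1 : ∀ x, coordProj s (σ (coordProj t (σ.symm x))) = coordProj s x :=
    ((hT s).coordProj_comp_eq hf).resolve_left fun h => hx (h x)
  -- The dichotomy so far gives only that the image of factor `t` contains factor `s`. The same
  -- dichotomy for `σ.symm`, with `s` and `t` exchanged, gives equality; its zero case contradicts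
  -- `hx` by commutation.
  have hg := (isOrthogonalProjection_coordProj T s).conj hσ.symm
  have hcomm : ∀ x, coordProj s (σ (coordProj t (σ.symm x))) =
      σ (coordProj t (σ.symm (coordProj s x))) :=
    (isOrthogonalProjection_coordProj T s).commute hf
  refine ⟨s, fun y => ?_⟩
  rcases (hT t).coordProj_comp_eq hg with h | h
  · refine absurd ?_ hx
    have := h (σ.symm x)
    simp only [LinearMap.comp_apply, LinearEquiv.coe_coe, LinearEquiv.symm_symm,
      LinearEquiv.apply_symm_apply] at this
    rw [hcomm, this, map_zero]
  · have := h y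
    simp only [LinearMap.comp_apply, LinearEquiv.coe_coe, LinearEquiv.symm_symm] at this
    rw [← this, ← hcomm, h1]

/-- Since the image of factor `t` lies in factor `s`, the sum defining `ψ` on the product reduces to
the single term at `s`. -/
theorem IsIsomorphism.isMorphism_block {σ : (∀ i, P i) ≃ₗ[ℤ] ∀ i, P i} {s t : ι}
    (hσ : (prod T).IsIsomorphism (prod T) σ) (h : ∀ x, σ (coordProj t x) = coordProj s (σ x)) :
    (T t).IsMorphism (T s) (LinearMap.proj s ∘ₗ σ.toLinearMap ∘ₗ LinearMap.single ℤ P t) := by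
  refine ⟨(isHodgeMorphism_proj T s).comp (hσ.1.1.comp (isMorphism_single T t).1), fun x y => ?_⟩
  have h1 := hσ.1.2 (Pi.single t x) (Pi.single t y)
  have h2 := (isMorphism_single T t).2 x y
  simp only [LinearMap.single_apply] at h2
  rw [h2, LinearEquiv.coe_coe, ← single_apply_of_coordProj_comm h x, prod_ψ_single_left] at h1
  exact h1

theorem IsIsomorphism.blockEquiv {σ : (∀ i, P i) ≃ₗ[ℤ] ∀ i, P i} {s t : ι}
    (hσ : (prod T).IsIsomorphism (prod T) σ) (h : ∀ x, σ (coordProj t x) = coordProj s (σ x)) :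
    (T t).IsIsomorphism (T s) (blockEquiv σ h) :=
  ⟨hσ.isMorphism_block h, hσ.symm.isMorphism_block (coordProj_comm_symm h)⟩

/-- A monomial map whose entries are morphisms is a morphism. -/
theorem isMorphism_of_monomial {f : (∀ i, P i) →ₗ[ℤ] ∀ i, P i} (ρ : Equiv.Perm ι)
    (a : ∀ s, P (ρ s) →ₗ[ℤ] P s) (ha : ∀ s, (T (ρ s)).IsMorphism (T s) (a s))
    (hf : ∀ x s, f x s = a s (x (ρ s))) : (prod T).IsMorphism (prod T) f := by
  refine ⟨isHodgeMorphism_prod fun s => ?_, fun x y => ?_⟩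
  · have : LinearMap.proj s ∘ₗ f = a s ∘ₗ LinearMap.proj (ρ s) := LinearMap.ext fun x => hf x s
    rw [this]
    exact (ha s).1.comp (isHodgeMorphism_proj T (ρ s))
  · simp only [prod_ψ_apply, hf, (ha _).2]
    exact Equiv.sum_comp ρ fun s => (T s).ψ (x s) (y s)

/-! ### The automorphism group of a product of powers -/

variable {κ : Type*} [Fintype κ] [DecidableEq κ] {α : κ → Type*} [∀ i, Fintype (α i)]
  [∀ i, DecidableEq (α i)] {M : κ → Type*} [∀ i, AddCommGroup (M i)]
  [∀ i, Module.Free ℤ (M i)] [∀ i, Module.Finite ℤ (M i)]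
  {T : ∀ i, PolarisedHodgeStructure (M i)}

/-- The monomial automorphism of `∏ᵢ Lᵢ^{αᵢ}` given by automorphisms of the factors and
permutations of the `αᵢ`. -/
def monomialEquiv (a : ∀ i, α i → (T i).Aut) (π : ∀ i, Equiv.Perm (α i)) :
    (∀ s : (i : κ) × α i, M s.1) ≃ₗ[ℤ] ∀ s : (i : κ) × α i, M s.1 where
  -- The inverse permutation makes this a left action, in agreement with `mulAutArrow`, which
  -- permutes coordinates by `k ↦ π⁻¹ k`.
  toFun x s := (a s.1 s.2).1 (x ⟨s.1, (π s.1).symm s.2⟩)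
  invFun x s := (a s.1 (π s.1 s.2)).1.symm (x ⟨s.1, π s.1 s.2⟩)
  map_add' x y := by ext s; simp
  map_smul' c x := by ext s; simp
  left_inv x := by
    ext ⟨i, k⟩
    have h : ∀ k', k' = k → x ⟨i, k'⟩ = x ⟨i, k⟩ := fun k' hk => by rw [hk]
    simpa using h _ ((π i).symm_apply_apply k)
  right_inv x := by
    ext ⟨i, k⟩
    have h : ∀ k', k' = k → x ⟨i, k'⟩ = x ⟨i, k⟩ := fun k' hk => by rw [hk]
    simpa using h _ ((π i).apply_symm_apply k)

theorem isIsomorphism_monomialEquiv (a : ∀ i, α i → (T i).Aut) (π : ∀ i, Equiv.Perm (α i)) :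
    (prod fun s : (i : κ) × α i => T s.1).IsIsomorphism (prod fun s : (i : κ) × α i => T s.1)
      (monomialEquiv a π) :=
  ⟨isMorphism_of_monomial (T := fun s : (i : κ) × α i => T s.1)
      (Equiv.sigmaCongrRight fun i => (π i).symm)
      (fun s => (a s.1 s.2).1.toLinearMap) (fun s => (a s.1 s.2).2.1) fun _ _ => rfl,
    isMorphism_of_monomial (T := fun s : (i : κ) × α i => T s.1) (Equiv.sigmaCongrRight π)
      (fun s => (a s.1 (π s.1 s.2)).1.symm.toLinearMap) (fun s => (a s.1 (π s.1 s.2)).2.2)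
      fun _ _ => rfl⟩

/-- The homomorphism from the product of the wreath products to the automorphism group. -/
def monomialHom (T : ∀ i, PolarisedHodgeStructure (M i)) (α : κ → Type*) [∀ i, Fintype (α i)]
    [∀ i, DecidableEq (α i)] :
    ((i : κ) → (α i → (T i).Aut) ⋊[mulAutArrow] Equiv.Perm (α i)) →*
      (prod fun s : (i : κ) × α i => T s.1).Aut where
  toFun w := ⟨monomialEquiv (fun i => (w i).left) fun i => (w i).right,
    isIsomorphism_monomialEquiv _ _⟩
  map_one' := by
    refine Subtype.ext (LinearEquiv.ext fun x => ?_)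
    ext ⟨i, k⟩
    rfl
  map_mul' w w' := by
    refine Subtype.ext (LinearEquiv.ext fun x => ?_)
    ext ⟨i, k⟩
    rfl

theorem monomialHom_apply (w : (i : κ) → (α i → (T i).Aut) ⋊[mulAutArrow] Equiv.Perm (α i))
    (x : ∀ s : (i : κ) × α i, M s.1) (i : κ) (k : α i) :
    (monomialHom T α w).1 x ⟨i, k⟩ = ((w i).left k).1 (x ⟨i, (w i).right.symm k⟩) := rfl

/-- Indecomposable structures are nonzero, so vectors supported in one coordinate detect first the
permutation and then each entry. -/
theorem monomialHom_injective (hT : ∀ i, (T i).Indecomposable) :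
    Function.Injective (monomialHom T α) := by
  refine (injective_iff_map_eq_one _).2 fun w hw => funext fun i => ?_
  have h : ∀ (x : ∀ s : (i : κ) × α i, M s.1) (k : α i),
      ((w i).left k).1 (x ⟨i, (w i).right.symm k⟩) = x ⟨i, k⟩ := fun x k => by
    rw [← monomialHom_apply, hw]
    rfl
  have hπ : ∀ k, (w i).right.symm k = k := fun k => by
    have := (hT i).1
    obtain ⟨y, hy⟩ := exists_ne (0 : M i)
    by_contra hk
    have h1 := h (Pi.single (M := fun s : (i : κ) × α i => M s.1) ⟨i, k⟩ y) k
    rw [Pi.single_eq_same, Pi.single_eq_of_ne (by simpa using hk), map_zero] at h1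
    exact hy h1.symm
  refine SemidirectProduct.ext (funext fun k => Subtype.ext (LinearEquiv.ext fun y => ?_))
    (Equiv.ext fun k => ?_)
  · have h1 := h (Pi.single (M := fun s : (i : κ) × α i => M s.1) ⟨i, k⟩ y) k
    rw [hπ, Pi.single_eq_same] at h1
    exact h1
  · exact ((w i).right.symm_apply_eq.1 (hπ k)).symm

/-- An automorphism maps each factor isomorphically onto another one, which belongs to the same `i`
since different `T i` are not isomorphic. This yields the permutations, and the induced isomorphisms
between factors are the entries. -/
theorem monomialHom_surjective (hT : ∀ i, (T i).Indecomposable)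
    (hnoniso : ∀ i j, i ≠ j → ¬ (T i).Isomorphic (T j)) :
    Function.Surjective (monomialHom T α) := by
  rintro ⟨σ, hσ⟩
  have hex : ∀ i (k : α i), ∃ k' : α i, ∀ x : ∀ s : (i : κ) × α i, M s.1,
      σ (coordProj ⟨i, k⟩ x) = coordProj ⟨i, k'⟩ (σ x) := by
    intro i k
    obtain ⟨⟨j, k'⟩, h⟩ := IsIsomorphism.exists_coordProj_comm
      (T := fun s : (i : κ) × α i => T s.1) (fun s => hT s.1) hσ ⟨i, k⟩
    obtain rfl : i = j := by
      by_contra hij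
      exact hnoniso i j hij ⟨_, IsIsomorphism.blockEquiv
        (T := fun s : (i : κ) × α i => T s.1) hσ h⟩
    exact ⟨k', h⟩
  choose p hp using hex
  -- Two factors with the same target would have the same coordinate projection, since `σ` is
  -- injective; a nonzero vector of one of them separates the two.
  have hinj : ∀ i, Function.Injective (p i) := by
    intro i k l hkl
    have := (hT i).1
    obtain ⟨y, hy⟩ := exists_ne (0 : M i)
    have h1 := hp i k (Pi.single (M := fun s : (i : κ) × α i => M s.1) ⟨i, k⟩ y)
    rw [hkl, ← hp i l] at h1
    have h2 := congrFun (σ.injective h1) ⟨i, k⟩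
    by_contra hne
    rw [coordProj_single, coordProj_apply, Pi.single_eq_same,
      Pi.single_eq_of_ne (by simpa using hne)] at h2
    exact hy h2
  let π : ∀ i, Equiv.Perm (α i) := fun i =>
    Equiv.ofBijective (p i) (Finite.injective_iff_bijective.1 (hinj i))
  have hπ : ∀ i k, ∀ x : ∀ s : (i : κ) × α i, M s.1,
      σ (coordProj ⟨i, (π i).symm k⟩ x) = coordProj ⟨i, k⟩ (σ x) := fun i k x => by
    have h : p i ((π i).symm k) = k := (π i).apply_symm_apply k
    rw [hp, h]
  refine ⟨fun i => ⟨fun k => ⟨blockEquiv (P := fun s : (i : κ) × α i => M s.1) σ (hπ i k),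
    IsIsomorphism.blockEquiv
    (T := fun s : (i : κ) × α i => T s.1) hσ (hπ i k)⟩, π i⟩, ?_⟩
  refine Subtype.ext (LinearEquiv.ext fun x => ?_)
  ext ⟨i, k⟩
  rw [monomialHom_apply]
  -- The coordinate `k` of `σ x` depends only on the coordinate of `x` that the permutation sends to
  -- `k`.
  have h := congrFun (hπ i k x) ⟨i, k⟩
  rw [coordProj_apply, coordProj_apply, Pi.single_eq_same] at h
  exact h

end PolarisedHodgeStructure

theorem corollary1p6
    {L : Type*} [AddCommGroup L] [Module.Free ℤ L] [Module.Finite ℤ L]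
    (S : PolarisedHodgeStructure L)
    {r : ℕ} {M : Fin r → Type*} [∀ i, AddCommGroup (M i)]
    [∀ i, Module.Free ℤ (M i)] [∀ i, Module.Finite ℤ (M i)]
    (T : ∀ i, PolarisedHodgeStructure (M i)) (e : Fin r → ℕ)
    (hindec : ∀ i, (T i).Indecomposable)
    (hnoniso : ∀ i j, i ≠ j → ¬ (T i).Isomorphic (T j))
    (hdecomp : S.Isomorphic
      (PolarisedHodgeStructure.prod (fun s : (i : Fin r) × Fin (e i) => T s.1))) :
    Nonempty (S.Aut ≃*
      ((i : Fin r) → (Fin (e i) → (T i).Aut) ⋊[mulAutArrow] Equiv.Perm (Fin (e i)))) := by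
  obtain ⟨σ, hσ⟩ := hdecomp
  exact ⟨hσ.autCongr.trans (MulEquiv.ofBijective
    (PolarisedHodgeStructure.monomialHom T fun i => Fin (e i))
    ⟨PolarisedHodgeStructure.monomialHom_injective hindec,
      PolarisedHodgeStructure.monomialHom_surjective hindec hnoniso⟩).symm⟩
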